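/- **Setting.** Let $p$ be an odd prime, $n\ge 1$, $q=p^n$, and let $m\ge 1$ be a divisor of $q-1$. Let $S_{q,m}=\{\alpha^m:\alpha\in\mathbb F_q^*\}$, let $T$ be the group of all translations $\beta\mapsto\beta+\alpha$ of $\mathbb F_q$ ($\alpha\in\mathbb F_q$), let $Z_{q,m}$ be the group of all maps $\beta\mapsto\beta\alpha$ with $\alpha\in S_{q,m}$, and let $G_{q,m}=\langle T,Z_{q,m}\rangle=T\rtimes Z_{q,m}$, a permutation group on $\mathbb F_q$. Put $r=(q-1)/m$, and let $\bar m=m$ if $r$ is even and $\bar m=m/2$ if $r$ is odd. For a natural number $k$ with $2k\mid q-1$, the generalized Paley graph $\Gamma_{q,k}$ is the undirected graph with vertex set $\mathbb F_q$ in which $\alpha,\beta$ are adjacent if and only if $\alpha-\beta\in S_{q,k}$. Write $\omega$ and $\chi$ for the clique number and the chromatic number. A section of a partition $\mathcal P$ of a finite set $\Omega$ is a subset of $\Omega$ that contains exactly one element of each part. For $G\le\mathrm{Sym}(\Omega)$, the partition $\mathcal P$ is $G$-regular if it has a section $S$ such that $Sg$ is a section of $\mathcal P$ for all $g\in G$.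 The group $G$ is synchronizing if $G\ne 1$ and the only $G$-regular partitions are the trivial ones, $\{\Omega\}$ and $\{\{x\}: x\in\Omega\}$; otherwise it is non-synchronizing. **Theorem 5.2.** The following hold. 1. If $\bar m>1$ and $\omega(\Gamma_{q,\bar m})=\chi(\Gamma_{q,\bar m})$, then $G_{q,m}$ is non-synchronizing. 2. If $m\in\{2,3\}$ and $2m\mid q-1$ (which is automatic for $m=3$), then $G_{q,m}$ is non-synchronizing if and only if $\omega(\Gamma_{q,m})=\chi(\Gamma_{q,m})$. 3. If $n$ is a prime, $m\in\{2,3\}$ and $m\nmid p^{n-1}+p^{n-2}+\cdots+p+1$, then $G_{q,m}$ is synchronizing. 4. If $n$ is even and $\gcd(m,p^{n/2}+1)\neq 1$, then $G_{q,m}$ is non-synchronizing. 5. If $n$ is odd, then $G_{q,2}$ is synchronizing. 6. If $n=2$, then $G_{p^2,2}$ is non-synchronizing; and if moreover $3\mid p^2-1$, then $G_{p^2,3}$ is non-synchronizing if and only if $3\mid p+1$. -/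

import Mathlib

namespace PaleySync

/-! ### Synchronizing permutation groups -/

/-- `S` is a section for the partition `P`: it contains precisely one element of each part. -/
def IsSection {Ω : Type*} (P : Set (Set Ω)) (S : Set Ω) : Prop :=
  ∀ B ∈ P, ∃! x, x ∈ S ∧ x ∈ B

/-- `P` is a `G`-regular partition: some section `S` has all its images under `G` sections too. -/
def IsRegularPartition {Ω : Type*} (G : Subgroup (Equiv.Perm Ω)) (P : Set (Set Ω)) : Prop :=
  Setoid.IsPartition P ∧
    ∃ S : Set Ω, IsSection P S ∧ ∀ g ∈ G, IsSection P ((fun x => g x) '' S)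

/-- The two trivial partitions: a single part, or all parts singletons. -/
def IsTrivialPartition {Ω : Type*} (P : Set (Set Ω)) : Prop :=
  P = {Set.univ} ∨ P = Set.range (fun x : Ω => ({x} : Set Ω))

/-- `G` is synchronizing: `G ≠ 1`, and every `G`-regular partition is trivial. -/
def IsSynchronizing {Ω : Type*} (G : Subgroup (Equiv.Perm Ω)) : Prop :=
  G ≠ ⊥ ∧ ∀ P : Set (Set Ω), IsRegularPartition G P → IsTrivialPartition P

/-! ### The affine groups -/

/-- The subgroup of `m`-th powers in the multiplicative group of `F`. -/
def powerSubgroup (F : Type*) [Field F] (m : ℕ) : Subgroup Fˣ :=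
  (powMonoidHom m : Fˣ →* Fˣ).range

/-- The group of translations `x ↦ x + a`. -/
def translations (F : Type*) [Field F] : Subgroup (Equiv.Perm F) where
  carrier := Set.range (fun a : F => Equiv.addRight a)
  mul_mem' := by
    rintro _ _ ⟨a, rfl⟩ ⟨b, rfl⟩
    exact ⟨b + a, by ext x; simp [add_assoc]⟩
  one_mem' := ⟨0, by ext x; simp⟩
  inv_mem' := by
    rintro _ ⟨a, rfl⟩
    exact ⟨-a, by ext x; simp⟩

/-- The group of multiplications `x ↦ u * x` by `m`-th powers `u` of nonzero elements. -/
def multiplications (F : Type*) [Field F] (m : ℕ) : Subgroup (Equiv.Perm F) :=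
  (powerSubgroup F m).map (MulAction.toPermHom Fˣ F)

/-- The permutation group generated by the translations and by the multiplications by `m`-th
powers. The second group normalizes the first and meets it trivially, so that this is
their internal semidirect product. -/
def affineGroup (F : Type*) [Field F] (m : ℕ) : Subgroup (Equiv.Perm F) :=
  translations F ⊔ multiplications F m

/-! ### Generalized Paley graphs -/

/-- The generalized Paley graph: distinct `a`, `b` are adjacent when `a - b` (or `b - a`) is an
`m`-th power of a nonzero element. It is considered when `2 * m ∣ |F| - 1`; then
`-1` is an `m`-th power and the two conditions agree, see `paleyGraph_adj`. -/
def paleyGraph (F : Type*) [Field F] (m : ℕ) : SimpleGraph F :=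
  SimpleGraph.fromRel (fun a b => ∃ u ∈ powerSubgroup F m, a - b = (u : F))

theorem neg_one_mem_powerSubgroup {F : Type*} [Field F] [Fintype F] {m : ℕ}
    (hm : 2 * m ∣ Fintype.card F - 1) :
    (-1 : Fˣ) ∈ powerSubgroup F m := by
  obtain ⟨k, hk⟩ := hm
  obtain ⟨g, hg⟩ := IsCyclic.exists_generator (α := Fˣ)
  have ho : orderOf g = 2 * (m * k) := by
    rw [orderOf_eq_card_of_forall_mem_zpowers hg, Nat.card_units, Nat.card_eq_fintype_card, hk]
    ring
  have hpos : 0 < m * k := by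
    have := orderOf_pos g
    omega
  have h2 : ((g ^ (m * k) : Fˣ) : F) = 1 ∨ ((g ^ (m * k) : Fˣ) : F) = -1 := by
    rw [← sq_eq_one_iff, ← Units.val_pow_eq_pow_val, ← pow_mul, mul_comm, ← ho, pow_orderOf_eq_one,
      Units.val_one]
  rcases h2 with h | h
  · have h1 : g ^ (m * k) = 1 := Units.ext h
    have := Nat.le_of_dvd hpos (orderOf_dvd_of_pow_eq_one h1)
    omega
  · exact ⟨g ^ k, by
      apply Units.ext
      rw [powMonoidHom_apply, ← pow_mul, mul_comm k m, h]
      simp⟩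

theorem paleyGraph_adj {F : Type*} [Field F] [Fintype F] {m : ℕ}
    (hm : 2 * m ∣ Fintype.card F - 1) (a b : F) :
    (paleyGraph F m).Adj a b ↔ ∃ u ∈ powerSubgroup F m, a - b = (u : F) := by
  rw [paleyGraph, SimpleGraph.fromRel_adj]
  constructor
  · rintro ⟨-, h | ⟨u, hu, h⟩⟩
    · exact h
    · refine ⟨-1 * u, mul_mem (neg_one_mem_powerSubgroup hm) hu, ?_⟩
      rw [← neg_sub b a, h]
      simp
  · rintro ⟨u, hu, h⟩
    refine ⟨?_, Or.inl ⟨u, hu, h⟩⟩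
    rintro rfl
    exact u.ne_zero (by rw [← h, sub_self])

/-- The number `m̄`: with `r = (q - 1) / m`, it is `m` if `r` is even and `m / 2` if `r` is odd.
(For `q` odd and `m ∣ q - 1`, if `r` is odd then `m` is even.) -/
def mbar (q m : ℕ) : ℕ :=
  if Even ((q - 1) / m) then m else m / 2

/-- The clique number of `Γ` equals its chromatic number. -/
def CliqueEqChromatic {V : Type*} (Γ : SimpleGraph V) : Prop :=
  (Γ.cliqueNum : ℕ∞) = Γ.chromaticNumber

end PaleySync

namespace PaleySync

open Finset

variable {F : Type*} [Field F]

/-! Let H be the group of m-th powers. Non-synchronization amounts to an H-factorization: sets A, C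
with more than one element each such that A - uC is a direct decomposition of F for every u in H.
From a nontrivial regular partition, take A a part and C a section; conversely the translates A + c
form such a partition, with section C.

Factorizations come from two sources: a colour class and a maximum clique when ω = χ
(`exists_isFactorization_of_cliqueEqChromatic`), or gK and K for a subfield K of index two
(`exists_isFactorization_of_card_eq_sq`).

For the converses, A and C have differences in disjoint sets of cosets of H. With at most three
cosets, one factor has all its differences in a single coset, so it scales to a clique and the
factorization yields a colouring. With two cosets both factors have size √q, which forces n even.
Finally, directness survives dilation by integers prime to p (`IsDirect.prime_mul`). If a
prime-field element generates Fˣ/H, directness holds for all u, which is absurd. -/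

/-- The map `(a, c) ↦ a - u * c` is injective on `A × C`. -/
def IsDirect (A C : Finset F) (u : F) : Prop :=
  ∀ a ∈ A, ∀ a' ∈ A, ∀ c ∈ C, ∀ c' ∈ C, a - a' = u * (c - c') → a = a' ∧ c = c'

/-- For every `u ∈ H` the field is the direct sum of `A` and `-u C`, and both summands are
nontrivial. -/
structure IsFactorization [Fintype F] (H : Subgroup Fˣ) (A C : Finset F) : Prop where
  one_lt_left : 1 < #A
  one_lt_right : 1 < #C
  card_mul : #A * #C = Fintype.card F
  direct : ∀ u ∈ H, IsDirect A C u

theorem IsDirect.injOn {A C : Finset F} {u : F} (h : IsDirect A C u) :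
    Set.InjOn (fun x : F × F => x.1 - u * x.2) (A ×ˢ C : Finset (F × F)) := by
  rintro ⟨a, c⟩ hx ⟨a', c'⟩ hy hxy
  simp only [coe_product, Set.mem_prod, mem_coe] at hx hy
  simp only at hxy
  obtain ⟨rfl, rfl⟩ := h a hx.1 a' hy.1 c hx.2 c' hy.2 (by linear_combination hxy)
  rfl

theorem IsDirect.card_mul_le [Fintype F] {A C : Finset F} {u : F} (h : IsDirect A C u) :
    #A * #C ≤ Fintype.card F := by
  classical
  rw [← card_product, ← card_image_of_injOn h.injOn]
  exact card_le_univ _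

theorem IsDirect.exists_sub_eq [Fintype F] {A C : Finset F} {u : F} (h : IsDirect A C u)
    (hc : #A * #C = Fintype.card F) (x : F) : ∃ a ∈ A, ∃ c ∈ C, a - u * c = x := by
  classical
  have := card_image_of_injOn h.injOn
  rw [card_product, hc, card_eq_iff_eq_univ] at this
  have hx := mem_univ x
  rw [← this] at hx
  obtain ⟨⟨a, c⟩, hac, rfl⟩ := mem_image.1 hx
  rw [mem_product] at hac
  exact ⟨a, hac.1, c, hac.2, rfl⟩

theorem isDirect_of_forall_exists [Fintype F] {A C : Finset F} {u : F}
    (hc : #A * #C = Fintype.card F) (hu : ∀ x, ∃ a ∈ A, ∃ c ∈ C, a - u * c = x) :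
    IsDirect A C u := by
  classical
  have hinj : Set.InjOn (fun x : F × F => x.1 - u * x.2) (A ×ˢ C : Finset (F × F)) := by
    rw [← card_image_iff, card_product, hc, card_eq_iff_eq_univ, eq_univ_iff_forall]
    intro x
    obtain ⟨a, ha, c, hc, rfl⟩ := hu x
    exact mem_image.2 ⟨(a, c), mem_product.2 ⟨ha, hc⟩, rfl⟩
  intro a ha a' ha' c hc c' hc' h
  have := @hinj (a, c) (by simp [ha, hc]) (a', c') (by simp [ha', hc'])
    (by simp only; linear_combination h)
  simpa using this

theorem isDirect_of_right {A C : Finset F} {u : F}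
    (h : ∀ a ∈ A, ∀ a' ∈ A, ∀ c ∈ C, ∀ c' ∈ C, a - a' = u * (c - c') → c = c') :
    IsDirect A C u := by
  intro a ha a' ha' c hc c' hc' hac
  obtain rfl := h a ha a' ha' c hc c' hc' hac
  exact ⟨by simpa [sub_eq_zero] using hac, rfl⟩

theorem IsDirect.swap {A C : Finset F} {u : F} (hu : u ≠ 0) (h : IsDirect A C u⁻¹) :
    IsDirect C A u := by
  intro c hc c' hc' a ha a' ha' hac
  exact (h a ha a' ha' c hc c' hc' (by rw [hac]; field_simp)).symm

theorem card_image_mul [DecidableEq F] {v : F} (hv : v ≠ 0) (C : Finset F) :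
    #(C.image (v * ·)) = #C :=
  card_image_of_injective _ (mul_right_injective₀ hv)

theorem IsFactorization.swap [Fintype F] {H : Subgroup Fˣ} {A C : Finset F}
    (h : IsFactorization H A C) : IsFactorization H C A where
  one_lt_left := h.one_lt_right
  one_lt_right := h.one_lt_left
  card_mul := by rw [mul_comm, h.card_mul]
  direct u hu := by
    refine IsDirect.swap u.ne_zero ?_
    rw [← Units.val_inv_eq_inv_val]
    exact h.direct _ (inv_mem hu)

theorem IsFactorization.mono [Fintype F] {H K : Subgroup Fˣ} (hHK : K ≤ H) {A C : Finset F}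
    (h : IsFactorization H A C) : IsFactorization K A C :=
  ⟨h.one_lt_left, h.one_lt_right, h.card_mul, fun u hu => h.direct u (hHK hu)⟩

/-! ### Regular partitions and factorizations -/

theorem mem_affineGroup_iff {m : ℕ} {g : Equiv.Perm F} :
    g ∈ affineGroup F m ↔ ∃ u ∈ powerSubgroup F m, ∃ b : F, ∀ x, g x = u * x + b := by
  constructor
  · intro hg
    rw [affineGroup, Subgroup.sup_eq_closure] at hg
    induction hg using Subgroup.closure_induction with
    | mem g hg =>
      rcases hg with ⟨b, rfl⟩ | ⟨u, hu, rfl⟩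
      · exact ⟨1, one_mem _, b, by simp⟩
      · exact ⟨u, hu, 0, fun x => by simp [Units.smul_def]⟩
    | one => exact ⟨1, one_mem _, 0, by simp⟩
    | mul g h _ _ hg hh =>
      obtain ⟨u, hu, b, hg⟩ := hg
      obtain ⟨v, hv, c, hh⟩ := hh
      refine ⟨u * v, mul_mem hu hv, u * c + b, fun x => ?_⟩
      rw [Equiv.Perm.mul_apply, hh, hg]
      push_cast
      ring
    | inv g _ hg =>
      obtain ⟨u, hu, b, hg⟩ := hg
      refine ⟨u⁻¹, inv_mem hu, -(u⁻¹ * b : F), fun x => ?_⟩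
      rw [Equiv.Perm.inv_eq_iff_eq, hg]
      have := u.ne_zero
      push_cast
      field_simp
      ring
  · rintro ⟨u, hu, b, hg⟩
    have : g = Equiv.addRight b * MulAction.toPermHom Fˣ F u := by
      ext x
      simp [hg, Units.smul_def]
    rw [this]
    exact mul_mem (Subgroup.mem_sup_left ⟨b, rfl⟩) (Subgroup.mem_sup_right ⟨u, hu, rfl⟩)

theorem affineGroup_ne_bot (m : ℕ) : affineGroup F m ≠ ⊥ := by
  intro h
  have h1 : Equiv.addRight (1 : F) ∈ affineGroup F m := Subgroup.mem_sup_left ⟨1, rfl⟩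
  rw [h, Subgroup.mem_bot] at h1
  simpa using congrArg (fun g : Equiv.Perm F => g 0) h1

theorem exists_isFactorization_of_not_isSynchronizing [Fintype F] {m : ℕ}
    (h : ¬ IsSynchronizing (affineGroup F m)) :
    ∃ A C : Finset F, IsFactorization (powerSubgroup F m) A C := by
  classical
  rw [IsSynchronizing, not_and] at h
  have h := h (affineGroup_ne_bot m)
  push Not at h
  obtain ⟨P, ⟨hP, S, -, hS⟩, hnt⟩ := h
  rw [IsTrivialPartition, not_or] at hnt
  have key : ∀ B ∈ P, ∀ u ∈ powerSubgroup F m, ∀ b : F,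
      ∃! y, y ∈ (fun x : F => (u : F) * x + b) '' S ∧ y ∈ B := by
    intro B hB u hu b
    have := hS (Equiv.addRight b * MulAction.toPermHom Fˣ F u)
      (mem_affineGroup_iff.2 ⟨u, hu, b, fun x => by simp [Units.smul_def]⟩) B hB
    simpa [Units.smul_def] using this
  have hdir : ∀ B ∈ P, ∀ u ∈ powerSubgroup F m, IsDirect B.toFinset S.toFinset (u : F) := by
    intro B hB u hu
    refine IsDirect.swap u.ne_zero (isDirect_of_right ?_)
    simp only [Set.mem_toFinset]
    intro s hs s' hs' y hy y' hy' hsy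
    have hsy' : u * (s - s') = y - y' := by
      rw [hsy]
      field_simp
    -- The translation is chosen so that the image of the section contains both y and y'.
    refine (key B hB u hu (y - u * s)).unique ⟨⟨s, hs, ?_⟩, hy⟩ ⟨⟨s', hs', ?_⟩, hy'⟩
    · simp
    · simp only
      linear_combination -hsy'
  have hcard : ∀ B ∈ P, #B.toFinset * #S.toFinset = Fintype.card F := by
    intro B hB
    refine le_antisymm (hdir B hB 1 (one_mem _)).card_mul_le ?_
    rw [← card_product, ← card_univ]
    refine card_le_card_of_surjOn (fun x : F × F => x.1 - x.2) ?_
    intro b _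
    obtain ⟨y, ⟨⟨s, hs, rfl⟩, hy⟩, -⟩ := key B hB 1 (one_mem _) b
    refine ⟨(s + b, s), ?_, by simp⟩
    simpa using And.intro hy hs
  obtain ⟨B₀, ⟨hB₀, -⟩, -⟩ := hP.2 0
  have hSpos : 0 < #S.toFinset :=
    Nat.pos_of_mul_pos_left ((hcard B₀ hB₀).symm ▸ Fintype.card_pos)
  have hS1 : 1 < #S.toFinset := by
    by_contra hS1
    have hS1 : #S.toFinset = 1 := by omega
    have huniv : ∀ B ∈ P, B = Set.univ := by
      intro B hB
      have := hcard B hB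
      rwa [hS1, mul_one, card_eq_iff_eq_univ, Set.toFinset_eq_univ] at this
    refine hnt.1 (Set.eq_singleton_iff_unique_mem.2 ⟨?_, huniv⟩)
    rw [← huniv B₀ hB₀]
    exact hB₀
  obtain ⟨B, hB, hB1⟩ : ∃ B ∈ P, 1 < #B.toFinset := by
    by_contra! hall
    apply hnt.2
    have hsub : ∀ B ∈ P, ∀ x ∈ B, B = {x} := by
      intro B hB x hx
      refine Set.eq_singleton_iff_unique_mem.2 ⟨hx, fun y hy => ?_⟩
      exact card_le_one.1 (hall B hB) y (by simpa using hy) x (by simpa using hx)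
    ext B
    constructor
    · intro hB
      obtain ⟨x, hx⟩ : B.Nonempty := by
        rw [Set.nonempty_iff_ne_empty]
        rintro rfl
        exact hP.1 hB
      exact ⟨x, (hsub B hB x hx).symm⟩
    · rintro ⟨x, rfl⟩
      obtain ⟨B, ⟨hB, hx⟩, -⟩ := hP.2 x
      have := hsub B hB x hx
      simpa only [← this] using hB
  exact ⟨B.toFinset, S.toFinset, hB1, hS1, hcard B hB, hdir B hB⟩

theorem IsFactorization.not_isSynchronizing [Fintype F] {m : ℕ} {A C : Finset F}
    (h : IsFactorization (powerSubgroup F m) A C) : ¬ IsSynchronizing (affineGroup F m) := by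
  rintro ⟨-, hsync⟩
  have hone : ∀ a ∈ A, ∀ a' ∈ A, ∀ c ∈ C, ∀ c' ∈ C, a + c = a' + c' → a = a' ∧ c = c' := by
    intro a ha a' ha' c hc c' hc' hac
    -- Exchanging c and c' turns uniqueness of differences into uniqueness of sums, so -1 need not
    -- be an m-th power.
    have := h.direct 1 (one_mem _) a ha a' ha' c' hc' c hc (by
      push_cast
      linear_combination hac)
    exact ⟨this.1, this.2.symm⟩
  have hcover : ∀ x : F, ∃ a ∈ A, ∃ c ∈ C, a + c = x := by
    have hneg : IsDirect A C (-1) := fun a ha a' ha' c hc c' hc' hac =>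
      hone a ha a' ha' c hc c' hc' (by linear_combination hac)
    intro x
    obtain ⟨a, ha, c, hc, rfl⟩ := hneg.exists_sub_eq h.card_mul x
    exact ⟨a, ha, c, hc, by ring⟩
  let P : Set (Set F) := (fun c : F => (fun a : F => a + c) '' A) '' C
  have hpart : Setoid.IsPartition P := by
    constructor
    · rintro ⟨c, -, hc⟩
      have : A = ∅ := by simpa only [Set.image_eq_empty, coe_eq_empty] using hc
      have hA := h.one_lt_left
      simp [this] at hA
    · intro x
      obtain ⟨a, ha, c, hc, rfl⟩ := hcover x
      refine ⟨_, ⟨⟨c, hc, rfl⟩, ⟨a, ha, rfl⟩⟩, ?_⟩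
      rintro _ ⟨⟨c', hc', rfl⟩, ⟨a', ha', hac⟩⟩
      rw [(hone a' ha' a ha c' hc' c hc hac).2]
  have hsec : ∀ u ∈ powerSubgroup F m, ∀ b : F,
      IsSection P ((fun x : F => (u : F) * x + b) '' C) := by
    rintro u hu b _ ⟨c, hc, rfl⟩
    obtain ⟨a, ha, s, hs, has⟩ := (h.direct u hu).exists_sub_eq h.card_mul (b - c)
    refine ⟨a + c, ⟨⟨s, hs, ?_⟩, ⟨a, ha, rfl⟩⟩, ?_⟩
    · simp only
      linear_combination -has
    · rintro _ ⟨⟨s', hs', hsa⟩, ⟨a', ha', rfl⟩⟩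
      simp only at hsa
      rw [(h.direct u hu a' ha' a ha s' hs' s hs (by linear_combination -has - hsa)).1]
  have hreg : IsRegularPartition (affineGroup F m) P := by
    refine ⟨hpart, C, ?_, fun g hg => ?_⟩
    · simpa using hsec 1 (one_mem _) 0
    · obtain ⟨u, hu, b, hgu⟩ := mem_affineGroup_iff.1 hg
      simpa only [hgu] using hsec u hu b
  obtain ⟨a, ha, a', ha', hne⟩ := one_lt_card.1 h.one_lt_left
  obtain ⟨c, hc, c', hc', hne'⟩ := one_lt_card.1 h.one_lt_right
  rcases hsync P hreg with htriv | htriv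
  · have hmem : (fun a : F => a + c) '' A ∈ P := ⟨c, hc, rfl⟩
    rw [htriv, Set.mem_singleton_iff] at hmem
    have hx : a + c' ∈ (fun a : F => a + c) '' A := hmem ▸ Set.mem_univ _
    obtain ⟨a₁, ha₁, hx⟩ := hx
    exact hne' (hone a₁ ha₁ a ha c hc c' hc' hx).2
  · have hmem : (fun a : F => a + c) '' A ∈ P := ⟨c, hc, rfl⟩
    rw [htriv] at hmem
    obtain ⟨x, hx⟩ := hmem
    have h1 : a + c ∈ ({x} : Set F) := hx.symm.subset ⟨a, ha, rfl⟩
    have h2 : a' + c ∈ ({x} : Set F) := hx.symm.subset ⟨a', ha', rfl⟩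
    rw [Set.mem_singleton_iff] at h1 h2
    exact hne (add_right_cancel (h1.trans h2.symm))

/-! ### Power subgroups of a finite field -/

theorem powerSubgroup_mono {d m : ℕ} (h : d ∣ m) : powerSubgroup F m ≤ powerSubgroup F d := by
  obtain ⟨k, rfl⟩ := h
  rintro _ ⟨x, rfl⟩
  exact ⟨x ^ k, by simp [← pow_mul, mul_comm]⟩

theorem index_powerSubgroup [Fintype F] {m : ℕ} (hm : m ∣ Fintype.card F - 1) :
    (powerSubgroup F m).index = m := by
  rw [powerSubgroup, IsCyclic.index_powMonoidHom_range, Nat.card_units, Nat.card_eq_fintype_card,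
    Nat.gcd_eq_right hm]

theorem exists_notMem_powerSubgroup [Fintype F] {m : ℕ} (hm : m ∣ Fintype.card F - 1)
    (h1 : m ≠ 1) : ∃ g : Fˣ, g ∉ powerSubgroup F m := by
  by_contra! h
  have := index_powerSubgroup hm
  rw [(Subgroup.eq_top_iff' _).2 h, Subgroup.index_top] at this
  exact h1 this.symm

theorem mem_powerSubgroup_of_pow_eq_one [Fintype F] {e f : ℕ} (hef : Fintype.card F - 1 = e * f)
    {x : Fˣ} (hx : x ^ e = 1) : x ∈ powerSubgroup F f := by
  obtain ⟨g, hg⟩ := IsCyclic.exists_generator (α := Fˣ)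
  have ho : orderOf g = e * f := by
    rw [orderOf_eq_card_of_forall_mem_zpowers hg, Nat.card_units, Nat.card_eq_fintype_card, hef]
  obtain ⟨i, rfl⟩ := mem_powers_iff_mem_zpowers.2 (hg x)
  have he : 0 < e := Nat.pos_of_mul_pos_right (ho ▸ orderOf_pos g)
  rw [← pow_mul, ← orderOf_dvd_iff_pow_eq_one, ho, mul_comm i] at hx
  obtain ⟨j, rfl⟩ := Nat.dvd_of_mul_dvd_mul_left he hx
  exact ⟨g ^ j, by simp [← pow_mul, mul_comm]⟩

/-! ### Dilations of direct factors -/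

/-- In the group ring of F over `ZMod r`, directness says that α γ = T, where α and γ are the sums
over A and -uC and T is the sum of all elements. Then α γ^r = |C|^(r-1) T, and by Frobenius γ^r is
the sum over -ruC. As |C| divides q, it is nonzero mod r, so every x occurs in A - ruC; counting
gives uniqueness. -/
theorem IsDirect.prime_mul [Fintype F] {A C : Finset F} {u : F} (h : IsDirect A C u)
    (hc : #A * #C = Fintype.card F) {r : ℕ} (hr : r.Prime) (hrq : r.Coprime (Fintype.card F)) :
    IsDirect A C (r * u) := by
  classical
  have : Fact r.Prime := ⟨hr⟩
  have : CharP (AddMonoidAlgebra (ZMod r) F) r :=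
    charP_of_injective_algebraMap (algebraMap (ZMod r) (AddMonoidAlgebra (ZMod r) F)).injective r
  refine isDirect_of_forall_exists hc fun x => ?_
  let e : F → AddMonoidAlgebra (ZMod r) F := fun x => AddMonoidAlgebra.single x 1
  have hee : ∀ x y, e x * e y = e (x + y) := fun x y => by simp [e]
  have hT : ∀ y, (∑ x, e x) * e y = ∑ x, e x := fun y => by
    rw [sum_mul]
    simp only [hee]
    exact Fintype.sum_equiv (Equiv.addRight y) _ _ fun x => rfl
  have hprod : (∑ a ∈ A, e a) * (∑ c ∈ C, e (-(u * c))) = ∑ x, e x := by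
    rw [sum_mul_sum, ← sum_product']
    simp only [hee, ← sub_eq_add_neg]
    rw [← sum_image (f := e) (g := fun x : F × F => x.1 - u * x.2) h.injOn]
    congr 1
    rw [← card_eq_iff_eq_univ, card_image_of_injOn h.injOn, card_product, hc]
  have hTpow : ∀ k, (∑ x, e x) * (∑ c ∈ C, e (-(u * c))) ^ k = (#C : ℕ) ^ k • ∑ x, e x := by
    intro k
    induction k with
    | zero => simp
    | succ k ih =>
      rw [pow_succ, ← mul_assoc, ih, smul_mul_assoc, mul_sum]
      simp only [hT, sum_const, smul_smul, pow_succ]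
  have hpow : (∑ a ∈ A, e a) * ∑ c ∈ C, e (-(r * u * c)) = (#C : ℕ) ^ (r - 1) • ∑ x, e x := by
    rw [← hTpow, ← hprod, mul_assoc, ← pow_succ', Nat.sub_add_cancel hr.one_lt.le, sum_pow_char]
    congr 1
    refine sum_congr rfl fun c _ => ?_
    simp [e, AddMonoidAlgebra.single_pow, mul_assoc]
  have hx := congrArg (fun f : AddMonoidAlgebra (ZMod r) F => f.coeff x) hpow
  simp only [sum_mul_sum, hee] at hx
  by_contra! hne
  have hne' : ∀ a ∈ A, ∀ c ∈ C, a + -(r * u * c) ≠ x := fun a ha c hc => by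
    rw [← sub_eq_add_neg]
    exact hne a ha c hc
  have hzero : (∑ a ∈ A, ∑ c ∈ C, e (a + -(r * u * c))).coeff x = 0 := by
    simp only [AddMonoidAlgebra.coeff_sum, Finsupp.finsetSum_apply]
    refine sum_eq_zero fun a ha => sum_eq_zero fun c hc => ?_
    simp [e, AddMonoidAlgebra.coeff_single, hne' a ha c hc]
  have hone : ((#C : ℕ) ^ (r - 1) • ∑ x, e x).coeff x = (#C : ZMod r) ^ (r - 1) := by
    rw [AddMonoidAlgebra.coeff_smul, Finsupp.smul_apply, AddMonoidAlgebra.coeff_sum,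
      Finsupp.finsetSum_apply]
    simp [e, AddMonoidAlgebra.coeff_single, Finsupp.single_apply]
  rw [hzero, hone] at hx
  have hC : (#C : ZMod r) = 0 := pow_eq_zero_iff (Nat.sub_pos_of_lt hr.one_lt).ne' |>.1 hx.symm
  rw [ZMod.natCast_eq_zero_iff] at hC
  exact Nat.not_coprime_of_dvd_of_dvd hr.one_lt dvd_rfl (hC.trans (Dvd.intro_left _ hc)) hrq

theorem IsDirect.natCast_mul [Fintype F] {A C : Finset F} {u : F} (h : IsDirect A C u)
    (hc : #A * #C = Fintype.card F) {r : ℕ} (hrq : r.Coprime (Fintype.card F)) :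
    IsDirect A C (r * u) := by
  induction r using Nat.recOnMul generalizing u with
  | zero =>
    rw [Nat.coprime_zero_left] at hrq
    exact absurd hrq (Fintype.one_lt_card (α := F)).ne'
  | one => simpa using h
  | prime r hr => exact h.prime_mul hc hr hrq
  | mul r s hr hs =>
    rw [Nat.coprime_mul_iff_left] at hrq
    simpa [mul_assoc] using hr (hs h hrq.2) hrq.1

theorem card_field_coprime_of_cast_ne_zero [Fintype F] {p n : ℕ} (hp : p.Prime)
    (hF : Fintype.card F = p ^ n) [CharP F p] {r : ℕ} (hr : (r : F) ≠ 0) :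
    r.Coprime (Fintype.card F) := by
  rw [hF]
  refine Nat.Coprime.pow_right n (Nat.Coprime.symm ?_)
  rwa [Nat.Prime.coprime_iff_not_dvd hp, ← CharP.cast_eq_zero_iff F p]

/-- An element of the prime field outside `powerSubgroup F m`. -/
theorem exists_natCast_notMem_powerSubgroup [Fintype F] {p n m : ℕ} (hp : p.Prime)
    (hF : Fintype.card F = p ^ n) [CharP F p] (hm : m ∣ p ^ n - 1)
    (hmn : ¬ m ∣ ∑ i ∈ range n, p ^ i) :
    ∃ (w : Fˣ) (r : ℕ), (w : F) = r ∧ w ∉ powerSubgroup F m := by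
  have : Fact p.Prime := ⟨hp⟩
  obtain ⟨g, hg⟩ := IsCyclic.exists_generator (α := Fˣ)
  have ho : orderOf g = p ^ n - 1 := by
    rw [orderOf_eq_card_of_forall_mem_zpowers hg, Nat.card_units, Nat.card_eq_fintype_card, hF]
  -- The exponent is (p^n - 1)/(p - 1), so w generates the units of the prime field.
  set w := g ^ ∑ i ∈ range n, p ^ i with hw
  have hwp : w ^ p = w := by
    obtain ⟨k, rfl⟩ : ∃ k, p = k + 1 := ⟨p - 1, (Nat.sub_add_cancel hp.one_lt.le).symm⟩
    have h1 : w ^ k = 1 := by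
      rw [hw, ← pow_mul, ← orderOf_dvd_iff_pow_eq_one, ho]
      rw [Nat.geomSum_eq hp.two_le n, Nat.add_sub_cancel, Nat.div_mul_cancel]
      simpa using Nat.sub_dvd_pow_sub_pow (k + 1) 1 n
    rw [pow_succ, h1, one_mul]
  have hbot : (w : F) ∈ (⊥ : Subfield F) := by
    rw [Subfield.mem_bot_iff_pow_eq_self F p, ← Units.val_pow_eq_pow_val, hwp]
  obtain ⟨z, hz⟩ := (mem_bot_iff_intCast p F).1 hbot
  have hp0 : (p : ℤ) ≠ 0 := by exact_mod_cast hp.ne_zero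
  refine ⟨w, (z % p).toNat, ?_, ?_⟩
  · have h1 : (((z % p).toNat : ℤ) : F) = ((z % p : ℤ) : F) := by
      rw [Int.toNat_of_nonneg (Int.emod_nonneg _ hp0)]
    rw [← Int.cast_natCast, h1, ← hz, CharP.intCast_eq_intCast F p]
    exact (Int.mod_modEq _ _).symm
  · rintro ⟨x, hx⟩
    obtain ⟨i, rfl⟩ := mem_powers_iff_mem_zpowers.2 (hg x)
    rw [powMonoidHom_apply, hw, ← pow_mul, pow_eq_pow_iff_modEq, ho] at hx
    have := hx.of_dvd hm
    exact hmn (Nat.modEq_zero_iff_dvd.1 (this.symm.trans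
      (Nat.modEq_zero_iff_dvd.2 (Dvd.intro_left _ rfl))))

/-- The quotient by the m-th powers has prime order, so it is generated by any nontrivial class,
here that of a prime-field element. Integer dilations then spread directness to all units. -/
theorem isSynchronizing_of_not_dvd_sum [Fintype F] {p n m : ℕ} (hp : p.Prime)
    (hF : Fintype.card F = p ^ n) (hm : m ∣ p ^ n - 1) (hmp : m.Prime)
    (hmn : ¬ m ∣ ∑ i ∈ range n, p ^ i) : IsSynchronizing (affineGroup F m) := by
  have : Fact p.Prime := ⟨hp⟩
  have : Fact m.Prime := ⟨hmp⟩
  have : CharP F p := charP_of_card_eq_prime_pow hF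
  by_contra hns
  obtain ⟨A, C, h⟩ := exists_isFactorization_of_not_isSynchronizing hns
  obtain ⟨w, r, hwr, hw⟩ := exists_natCast_notMem_powerSubgroup hp hF hm hmn
  have hcard : Nat.card (Fˣ ⧸ powerSubgroup F m) = m := by
    rw [← Subgroup.index_eq_card, index_powerSubgroup (hF ▸ hm)]
  have hall : ∀ v : Fˣ, IsDirect A C (v : F) := by
    intro v
    obtain ⟨j, hj⟩ := mem_powers_of_prime_card hcard
      (g := (w : Fˣ ⧸ powerSubgroup F m)) (g' := (v : Fˣ ⧸ powerSubgroup F m))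
      (by rwa [Ne, QuotientGroup.eq_one_iff])
    have hu : (w ^ j)⁻¹ * v ∈ powerSubgroup F m := QuotientGroup.eq.1 hj
    have hr : (r : F) ≠ 0 := hwr ▸ w.ne_zero
    have := (h.direct _ hu).natCast_mul h.card_mul
      ((card_field_coprime_of_cast_ne_zero hp hF hr).pow_left j)
    rw [Nat.cast_pow, ← hwr] at this
    simpa using this
  obtain ⟨a, ha, a', ha', hne⟩ := one_lt_card.1 h.one_lt_left
  obtain ⟨c, hc, c', hc', hne'⟩ := one_lt_card.1 h.one_lt_right
  have hc0 : c - c' ≠ 0 := sub_ne_zero.2 hne'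
  -- For this ratio a - a' = v(c - c'), contradicting directness.
  have := hall (Units.mk0 ((a - a') / (c - c')) (div_ne_zero (sub_ne_zero.2 hne) hc0))
    a ha a' ha' c hc c' hc' (by simp [hc0])
  exact hne this.1

/-! ### Subfields of index two -/

/-- Nonzero elements of the subfield K of order p^k are (p^k + 1)-th powers, hence d-th powers, as
are the elements of H. If g is not a d-th power, nonzero differences of gK and of uK never agree. -/
theorem exists_isFactorization_of_card_eq_sq [Fintype F] {p k m : ℕ} (hp : p.Prime)
    (hk : 0 < k) (hF : Fintype.card F = (p ^ k) ^ 2) (hd : Nat.gcd m (p ^ k + 1) ≠ 1) :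
    ∃ A C : Finset F, IsFactorization (powerSubgroup F m) A C := by
  classical
  have : Fact p.Prime := ⟨hp⟩
  have : CharP F p := charP_of_card_eq_prime_pow (f := k * 2) (by rw [hF, pow_mul])
  set d := Nat.gcd m (p ^ k + 1)
  have hs : 1 < p ^ k := Nat.one_lt_pow hk.ne' hp.one_lt
  have hqs : Fintype.card F - 1 = (p ^ k - 1) * (p ^ k + 1) := by
    rw [hF, mul_comm]
    simpa using Nat.sq_sub_sq (p ^ k) 1
  obtain ⟨g, hg⟩ := exists_notMem_powerSubgroup (F := F) (m := d)
    (hqs ▸ (Nat.gcd_dvd_right _ _).trans (Dvd.intro_left _ rfl)) hd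
  let K : Finset F := insert 0
    ((univ.filter fun u : Fˣ => u ^ (p ^ k - 1) = 1).map ⟨Units.val, Units.val_injective⟩)
  have hK : ∀ x ∈ K, x ^ p ^ k = x := by
    intro x hx
    rcases mem_insert.1 hx with rfl | hx
    · exact zero_pow (by omega)
    · obtain ⟨u, hu, rfl⟩ := mem_map.1 hx
      rw [mem_filter] at hu
      rw [Function.Embedding.coeFn_mk, ← Units.val_pow_eq_pow_val,
        ← Nat.sub_add_cancel hs.le, pow_succ, hu.2, one_mul]
  have hcard : #K = p ^ k := by
    rw [card_insert_of_notMem (by simp), card_map]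
    have h1 := IsCyclic.card_powMonoidHom_ker Fˣ (p ^ k - 1)
    rw [Nat.card_units, Nat.card_eq_fintype_card (α := F), hqs, Nat.gcd_mul_right_left] at h1
    have h2 : #(univ.filter fun u : Fˣ => u ^ (p ^ k - 1) = 1) = p ^ k - 1 := by
      refine Eq.trans ?_ h1
      rw [Nat.card_eq_fintype_card, Fintype.card_subtype]
      simp [MonoidHom.mem_ker]
    omega
  have hunit : ∀ x ∈ K, ∀ y ∈ K, ∀ v : Fˣ, (v : F) = x - y → v ∈ powerSubgroup F d := by
    intro x hx y hy v hv
    refine powerSubgroup_mono (Nat.gcd_dvd_right _ _) (mem_powerSubgroup_of_pow_eq_one hqs ?_)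
    have : v ^ p ^ k = v := by
      ext
      rw [Units.val_pow_eq_pow_val, hv, sub_pow_char_pow, hK x hx, hK y hy]
    rw [← Nat.sub_add_cancel hs.le, pow_succ] at this
    simpa using this
  refine ⟨K.image ((g : F) * ·), K, ?_, hcard ▸ hs, ?_, ?_⟩
  · rwa [card_image_mul g.ne_zero, hcard]
  · rw [card_image_mul g.ne_zero, hcard, hF, sq]
  · intro u hu
    refine isDirect_of_right ?_
    simp only [mem_image]
    rintro _ ⟨a, ha, rfl⟩ _ ⟨a', ha', rfl⟩ c hc c' hc' hac
    by_contra hne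
    have hc0 : c - c' ≠ 0 := sub_ne_zero.2 hne
    have ha0 : a - a' ≠ 0 := by
      intro h0
      rw [← mul_sub, h0, mul_zero] at hac
      exact mul_ne_zero u.ne_zero hc0 hac.symm
    have heq : g * Units.mk0 _ ha0 = u * Units.mk0 _ hc0 := by
      ext
      simpa [mul_sub] using hac
    apply hg
    rw [← Subgroup.mul_mem_cancel_right _ (hunit a ha a' ha' (Units.mk0 _ ha0) rfl), heq]
    exact mul_mem (powerSubgroup_mono (Nat.gcd_dvd_left _ _) hu)
      (hunit c hc c' hc' (Units.mk0 _ hc0) rfl)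

/-! ### Cliques and colourings of Paley graphs -/

theorem exists_isFactorization_of_cliqueEqChromatic [Fintype F] {k : ℕ}
    (hk : 2 * k ∣ Fintype.card F - 1) (hk1 : 1 < k)
    (h : CliqueEqChromatic (paleyGraph F k)) :
    ∃ A C : Finset F, IsFactorization (powerSubgroup F k) A C := by
  classical
  obtain ⟨C, hC, hCcard⟩ := (paleyGraph F k).exists_isNClique_cliqueNum
  rw [CliqueEqChromatic] at h
  obtain ⟨col⟩ := SimpleGraph.chromaticNumber_le_iff_colorable.1 h.ge
  set w := (paleyGraph F k).cliqueNum
  have hw2 : 1 < w := by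
    have hadj : (paleyGraph F k).Adj 1 0 :=
      (paleyGraph_adj hk 1 0).2 ⟨1, one_mem _, by simp⟩
    have := SimpleGraph.two_le_chromaticNumber_of_adj hadj
    rw [← h] at this
    exact_mod_cast this
  have hclique : ∀ c ∈ C, ∀ c' ∈ C, c ≠ c' → ∃ u ∈ powerSubgroup F k, c - c' = (u : F) :=
    fun c hc c' hc' hne => (paleyGraph_adj hk c c').1 (hC hc hc' hne)
  have hdir : ∀ i, ∀ u ∈ powerSubgroup F k, IsDirect (univ.filter (col · = i)) C (u : F) := by
    intro i u hu
    refine isDirect_of_right ?_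
    simp only [mem_filter]
    rintro a ⟨-, ha⟩ a' ⟨-, ha'⟩ c hc c' hc' hac
    by_contra hne
    obtain ⟨v, hv, hcv⟩ := hclique c hc c' hc' hne
    refine col.valid ((paleyGraph_adj hk a a').2 ⟨u * v, mul_mem hu hv, ?_⟩) (ha.trans ha'.symm)
    rw [hac, hcv, Units.val_mul]
  -- Pigeonhole: the w colour classes cover F and |C| = w, so some class has at least q/w elements.
  obtain ⟨i, hi⟩ : ∃ i, Fintype.card F ≤ #(univ.filter (col · = i)) * #C := by
    by_contra! hlt
    have : NeZero w := ⟨by omega⟩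
    have h1 := sum_lt_sum_of_nonempty (univ_nonempty (α := Fin w)) fun i _ => hlt i
    rw [← sum_mul, ← card_eq_sum_card_fiberwise (fun _ _ => mem_univ _), sum_const, card_univ,
      card_univ, Fintype.card_fin, hCcard, smul_eq_mul, mul_comm] at h1
    exact lt_irrefl _ h1
  have hcard := le_antisymm (hdir i 1 (one_mem _)).card_mul_le hi
  refine ⟨_, C, ?_, hCcard ▸ hw2, hcard, hdir i⟩
  by_contra hle
  -- A class with at most one element would make the clique all of F, so every unit would be a k-th
  -- power.
  have hC' : C = univ := by
    rw [← card_eq_iff_eq_univ]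
    refine le_antisymm (card_le_univ _) (hi.trans ?_)
    simpa using Nat.mul_le_mul_right #C (not_lt.1 hle)
  obtain ⟨g, hg⟩ := exists_notMem_powerSubgroup (F := F) (m := k)
    ((Dvd.intro_left _ rfl).trans hk) hk1.ne'
  obtain ⟨u, hu, hgu⟩ := hclique g (hC' ▸ mem_univ _) 0 (hC' ▸ mem_univ _) g.ne_zero
  rw [sub_zero, Units.val_inj] at hgu
  exact hg (hgu ▸ hu)

/-- The cosets met by differences of A and those met by differences of C are disjoint nonempty sets
among at most three, so one of them is a single coset. -/
theorem IsFactorization.exists_forall_sub_mem [Fintype F] {H : Subgroup Fˣ}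
    (hH : H.index ≤ 3) {A C : Finset F} (h : IsFactorization H A C) :
    ∃ (A' C' : Finset F) (d : Fˣ), IsFactorization H A' C' ∧
      ∀ c ∈ C', ∀ c' ∈ C', c ≠ c' → ∃ u ∈ H, c - c' = d * (u : F) := by
  classical
  let D : Finset F → Finset (Fˣ ⧸ H) := fun X =>
    Finset.image (QuotientGroup.mk (s := H))
      (univ.filter fun v : Fˣ => ∃ x ∈ X, ∃ x' ∈ X, (v : F) = x - x')
  have hDmem : ∀ X : Finset F, ∀ v : Fˣ, ∀ x ∈ X, ∀ x' ∈ X, (v : F) = x - x' →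
      (v : Fˣ ⧸ H) ∈ D X := by
    intro X v x hx x' hx' hv
    exact mem_image.2 ⟨v, mem_filter.2 ⟨mem_univ v, x, hx, x', hx', hv⟩, rfl⟩
  have hdisj : Disjoint (D A) (D C) := by
    rw [disjoint_left]
    intro _ hA hC
    obtain ⟨v, hv, rfl⟩ := mem_image.1 hA
    obtain ⟨w, hw, hvw⟩ := mem_image.1 hC
    obtain ⟨-, a, ha, a', ha', hv⟩ := mem_filter.1 hv
    obtain ⟨-, c, hc, c', hc', hw⟩ := mem_filter.1 hw
    have := (h.direct _ (QuotientGroup.eq.1 hvw) a ha a' ha' c hc c' hc' (by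
      rw [← hv, ← hw]
      push_cast
      field_simp)).1
    exact v.ne_zero (by rw [hv, this, sub_self])
  have hle : #(D A) + #(D C) ≤ 3 := by
    rw [← card_union_of_disjoint hdisj]
    refine (card_le_univ _).trans ?_
    rwa [← Nat.card_eq_fintype_card, ← Subgroup.index_eq_card]
  have hpos : ∀ X : Finset F, 1 < #X → ∃ d : Fˣ, (d : Fˣ ⧸ H) ∈ D X := by
    intro X hX
    obtain ⟨x, hx, x', hx', hne⟩ := one_lt_card.1 hX
    exact ⟨Units.mk0 _ (sub_ne_zero.2 hne), hDmem X _ x hx x' hx' rfl⟩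
  have main : ∀ X : Finset F, 1 < #X → #(D X) ≤ 1 →
      ∃ d : Fˣ, ∀ c ∈ X, ∀ c' ∈ X, c ≠ c' → ∃ u ∈ H, c - c' = d * (u : F) := by
    intro X hX hDX
    obtain ⟨d, hd⟩ := hpos X hX
    refine ⟨d, fun c hc c' hc' hne => ?_⟩
    have hv := hDmem X (Units.mk0 _ (sub_ne_zero.2 hne)) c hc c' hc' rfl
    refine ⟨_, QuotientGroup.eq.1 (card_le_one.1 hDX _ hd _ hv), ?_⟩
    simp
  by_cases hC1 : #(D C) ≤ 1
  · obtain ⟨d, hd⟩ := main C h.one_lt_right hC1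
    exact ⟨A, C, d, h, hd⟩
  · obtain ⟨d, hd⟩ := main A h.one_lt_left (by omega)
    exact ⟨C, A, d, h.swap, hd⟩

theorem IsFactorization.cliqueEqChromatic [Fintype F] {m : ℕ}
    (hm : 2 * m ∣ Fintype.card F - 1) (hm3 : m ≤ 3) {A C : Finset F}
    (h : IsFactorization (powerSubgroup F m) A C) : CliqueEqChromatic (paleyGraph F m) := by
  classical
  have hindex := index_powerSubgroup (F := F) (m := m) ((Dvd.intro_left _ rfl).trans hm)
  obtain ⟨A, C, d, h, hd⟩ := h.exists_forall_sub_mem (hindex.trans_le hm3)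
  refine le_antisymm SimpleGraph.cliqueNum_le_chromaticNumber ?_
  have hclique : (paleyGraph F m).IsClique (C.image (((d⁻¹ : Fˣ) : F) * ·) : Finset F) := by
    intro x hx y hy hxy
    rw [mem_coe, mem_image] at hx hy
    obtain ⟨c, hc, rfl⟩ := hx
    obtain ⟨c', hc', rfl⟩ := hy
    obtain ⟨u, hu, hcu⟩ := hd c hc c' hc' fun hcc => hxy (by rw [hcc])
    refine (paleyGraph_adj hm _ _).2 ⟨u, hu, ?_⟩
    rw [← mul_sub, hcu]
    simp
  have hle := SimpleGraph.IsClique.card_le_cliqueNum (tc := hclique)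
  rw [card_image_mul (Units.ne_zero _)] at hle
  refine le_trans ?_ (Nat.cast_le.2 hle)
  rw [SimpleGraph.chromaticNumber_le_iff_colorable]
  -- Taking u = -1 writes d * x as a + c; the colour of x is c. Neighbours of equal colour would
  -- give A a difference in dH, the coset of the differences of C.
  have hneg := h.direct (-1) (neg_one_mem_powerSubgroup hm)
  choose a ha c hc hac using fun x : F => hneg.exists_sub_eq h.card_mul (d * x)
  let col : (paleyGraph F m).Coloring C := SimpleGraph.Coloring.mk (fun x => ⟨c x, hc x⟩) (by
    intro x y hxy hcol
    obtain ⟨u, hu, hxyu⟩ := (paleyGraph_adj hm x y).1 hxy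
    have hcxy : c x = c y := congrArg Subtype.val hcol
    have hdiff : a x - a y = d * u := by
      rw [← hxyu, mul_sub, ← hac x, ← hac y, hcxy]
      ring
    obtain ⟨c₁, hc₁, c₂, hc₂, hne⟩ := one_lt_card.1 h.one_lt_right
    obtain ⟨v, hv, hcv⟩ := hd c₁ hc₁ c₂ hc₂ hne
    refine hne (h.direct (u * v⁻¹) (mul_mem hu (inv_mem hv)) (a x) (ha x) (a y) (ha y)
      c₁ hc₁ c₂ hc₂ ?_).2
    rw [hdiff, hcv]
    push_cast
    field_simp)
  simpa using col.colorable

/-! ### Squares -/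

/-- With two cosets, the differences of C all lie in one, so those of gC lie in the other when g is
outside H. Hence C - gC is direct. -/
theorem IsFactorization.card_right_sq_le [Fintype F] {H : Subgroup Fˣ} (hH : H.index = 2)
    {A C : Finset F} (h : IsFactorization H A C) : #C * #C ≤ Fintype.card F := by
  obtain ⟨g, hg⟩ : ∃ g, g ∉ H := by
    by_contra! hall
    rw [(Subgroup.eq_top_iff' _).2 hall, Subgroup.index_top] at hH
    omega
  obtain ⟨a, ha, a', ha', hne⟩ := one_lt_card.1 h.one_lt_left
  set x : Fˣ := Units.mk0 _ (sub_ne_zero.2 hne) with hx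
  have key : ∀ c ∈ C, ∀ c' ∈ C, ∀ v : Fˣ, (v : F) = c - c' → v⁻¹ * x ∉ H := by
    intro c hc c' hc' v hv hmem
    refine hne (h.direct _ hmem a ha a' ha' c hc c' hc' ?_).1
    rw [← hv]
    simp only [hx, Units.val_mul, Units.val_inv_eq_inv_val, Units.val_mk0]
    field_simp
  refine IsDirect.card_mul_le (u := (g : F)) (isDirect_of_right ?_)
  intro c₁ hc₁ c₂ hc₂ c₃ hc₃ c₄ hc₄ hcc
  by_contra hne₃
  have h₃ : c₃ - c₄ ≠ 0 := sub_ne_zero.2 hne₃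
  have h₁ : c₁ - c₂ ≠ 0 := hcc ▸ mul_ne_zero g.ne_zero h₃
  have k₁ := key c₁ hc₁ c₂ hc₂ (Units.mk0 _ h₁) rfl
  have k₃ := key c₃ hc₃ c₄ hc₄ (Units.mk0 _ h₃) rfl
  have heq : Units.mk0 _ h₁ = g * Units.mk0 _ h₃ := by
    ext
    simpa using hcc
  rw [heq, mul_inv_rev, mul_comm _ g⁻¹, mul_assoc, Subgroup.mul_mem_iff_of_index_two hH,
    inv_mem_iff] at k₁
  tauto

theorem isSynchronizing_two_of_odd [Fintype F] {p n : ℕ} (hp : p.Prime) (hp_odd : Odd p)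
    (hF : Fintype.card F = p ^ n) (hn : Odd n) : IsSynchronizing (affineGroup F 2) := by
  by_contra hns
  obtain ⟨A, C, h⟩ := exists_isFactorization_of_not_isSynchronizing hns
  have hindex : (powerSubgroup F 2).index = 2 := by
    refine index_powerSubgroup ?_
    rw [hF]
    exact (Nat.Odd.sub_odd hp_odd.pow odd_one).two_dvd
  have h1 := h.card_right_sq_le hindex
  have h2 := h.swap.card_right_sq_le hindex
  have h3 := h.card_mul
  have heq : #A = #C := by
    rcases lt_trichotomy #A #C with hlt | heq | hlt
    · nlinarith
    · exact heq
    · nlinarith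
  rw [heq, hF] at h3
  obtain ⟨k, -, hk⟩ := (Nat.dvd_prime_pow hp).1 (Dvd.intro _ h3)
  rw [hk, ← pow_add] at h3
  have := Nat.pow_right_injective hp.two_le h3
  obtain ⟨j, hj⟩ := hn
  omega

/-! ### Divisibility properties of `mbar` -/

theorem two_mul_mbar_dvd {q m : ℕ} (hq : Odd q) (hm : m ∣ q - 1) : 2 * mbar q m ∣ q - 1 := by
  have heven : Even (q - 1) := Nat.Odd.sub_odd hq odd_one
  obtain ⟨r, hr⟩ := hm
  rcases m.eq_zero_or_pos with rfl | hpos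
  · simp [mbar, hr]
  rw [mbar, hr, Nat.mul_div_cancel_left r hpos]
  split_ifs with h
  · obtain ⟨s, rfl⟩ := h
    exact ⟨s, by ring⟩
  · have : Even m := by
      rw [hr, Nat.even_mul] at heven
      tauto
    rw [Nat.two_mul_div_two_of_even this]
    exact Dvd.intro _ rfl

theorem mbar_dvd {q m : ℕ} (hq : Odd q) (hm : m ∣ q - 1) : mbar q m ∣ m := by
  have heven : Even (q - 1) := Nat.Odd.sub_odd hq odd_one
  rw [mbar]
  split_ifs with h
  · exact dvd_rfl
  · refine Nat.div_dvd_of_dvd (Even.two_dvd ?_)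
    rw [← Nat.mul_div_cancel' hm, Nat.even_mul] at heven
    tauto

end PaleySync

theorem theorem5p2 {F : Type*} [Field F] [Fintype F] (p n m : ℕ)
    (hp : p.Prime) (hp_odd : Odd p) (hn : 0 < n) (hF : Fintype.card F = p ^ n)
    (hm : m ∣ p ^ n - 1) :
    -- (1)
    (1 < PaleySync.mbar (p ^ n) m →
      PaleySync.CliqueEqChromatic (PaleySync.paleyGraph F (PaleySync.mbar (p ^ n) m)) →
      ¬ PaleySync.IsSynchronizing (PaleySync.affineGroup F m)) ∧
    -- (2)
    ((m = 2 ∨ m = 3) → 2 * m ∣ p ^ n - 1 →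
      (¬ PaleySync.IsSynchronizing (PaleySync.affineGroup F m) ↔
        PaleySync.CliqueEqChromatic (PaleySync.paleyGraph F m))) ∧
    -- (3)
    (n.Prime → (m = 2 ∨ m = 3) → ¬ m ∣ ∑ i ∈ Finset.range n, p ^ i →
      PaleySync.IsSynchronizing (PaleySync.affineGroup F m)) ∧
    -- (4)
    (Even n → Nat.gcd m (p ^ (n / 2) + 1) ≠ 1 →
      ¬ PaleySync.IsSynchronizing (PaleySync.affineGroup F m)) ∧
    -- (5)
    (Odd n → PaleySync.IsSynchronizing (PaleySync.affineGroup F 2)) ∧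
    -- (6)
    (n = 2 →
      ¬ PaleySync.IsSynchronizing (PaleySync.affineGroup F 2) ∧
      (3 ∣ p ^ 2 - 1 →
        (¬ PaleySync.IsSynchronizing (PaleySync.affineGroup F 3) ↔ 3 ∣ p + 1))) := by
  have hprime : ∀ k, k = 2 ∨ k = 3 → k.Prime := by
    rintro _ (rfl | rfl)
    exacts [Nat.prime_two, Nat.prime_three]
  have subfield : ∀ k, Even n → Nat.gcd k (p ^ (n / 2) + 1) ≠ 1 →
      ¬ PaleySync.IsSynchronizing (PaleySync.affineGroup F k) := by
    intro k hn2 hk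
    obtain ⟨A, C, h⟩ := PaleySync.exists_isFactorization_of_card_eq_sq hp
      (Nat.div_pos (Nat.le_of_dvd hn hn2.two_dvd) two_pos)
      (by rw [hF, ← pow_mul, Nat.div_mul_cancel hn2.two_dvd]) hk
    exact h.not_isSynchronizing
  refine ⟨fun h1 h => ?_, fun hm23 h2m => ⟨fun h => ?_, fun h => ?_⟩, fun _ hm23 h => ?_,
    subfield m, PaleySync.isSynchronizing_two_of_odd hp hp_odd hF, ?_⟩
  · obtain ⟨A, C, hAC⟩ := PaleySync.exists_isFactorization_of_cliqueEqChromatic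
      (by rw [hF]; exact PaleySync.two_mul_mbar_dvd hp_odd.pow hm) h1 h
    exact (hAC.mono (PaleySync.powerSubgroup_mono (PaleySync.mbar_dvd hp_odd.pow hm))).not_isSynchronizing
  · obtain ⟨A, C, hAC⟩ := PaleySync.exists_isFactorization_of_not_isSynchronizing h
    exact hAC.cliqueEqChromatic (hF ▸ h2m) (by omega)
  · obtain ⟨A, C, hAC⟩ := PaleySync.exists_isFactorization_of_cliqueEqChromatic
      (hF ▸ h2m) (hprime m hm23).one_lt h
    exact hAC.not_isSynchronizing
  · exact PaleySync.isSynchronizing_of_not_dvd_sum hp hF hm (hprime m hm23) h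
  · rintro rfl
    refine ⟨subfield 2 even_two ?_, fun h3 => ⟨fun h => ?_, fun h => subfield 3 even_two ?_⟩⟩
    · rw [Nat.gcd_eq_left (by simpa using hp_odd.add_one.two_dvd)]
      norm_num
    · by_contra hndvd
      refine h (PaleySync.isSynchronizing_of_not_dvd_sum hp hF h3 Nat.prime_three ?_)
      -- For n = 2 the geometric sum is p + 1, so the two criteria are complementary.
      simpa [Finset.sum_range_succ, add_comm] using hndvd
    · rw [Nat.gcd_eq_left (by simpa using h)]
      norm_num
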